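/- Let $E$ be a Dedekind complete Riesz space with weak order unit $e$, let $E^s$ be its sup-completion, and let $x\in E$. The multiplication of positive elements of $E^s$ is the one with unit $e$: $ab=\sup\{\alpha\beta\,(p\wedge q)\}$, the supremum being over reals $\alpha,\beta\ge 0$ and components $p,q$ of $e$ with $\alpha p\le a$ and $\beta q\le b$. **Daniell integral.** Let $e^x_t=P_{x\le te}e=e-\sup_n\big(e\wedge n(x-te)^+\big)$ for $t\in\mathbb R$, and $e^x_{-\infty}=0$, $e^x_{+\infty}=e$. Let $L$ be the space of step functions, i.e. finite linear combinations of indicator functions $\mathbf 1_{(a,b]\cap\mathbb R}$ with $-\infty\le a\le b\le+\infty$, and let $I_x:L\to E$ be linear with $I_x(\mathbf 1_{(a,b]\cap\mathbb R})=e^x_b-e^x_a$. Put - $L^{\uparrow}$: the functions $f:\mathbb R\to\overline{\mathbb R}$ for which there are $f_n\in L$ with $f_n\uparrow f$ pointwise; $I_x(f)=\sup_n I_x(f_n)\in E^s$; - $L_1^{\uparrow}(I_x)$: the functions $f:\mathbb R\to[0,\infty)$ in $L^\uparrow$ with $I_x(f)\in E$; - $L_1(I_x)=L_1^\uparrow(I_x)-L_1^\uparrow(I_x)$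 and $L_2(I_x)=L^\uparrow_+-L_1(I_x)$, with $I_x(u-v)=I_x(u)-I_x(v)$. The integral $I_x$ on step functions is extended further by monotone limits. Let $M(I_x)$ be the smallest class of pairs $(f,y)$, $f:\mathbb R\to\mathbb R$, $y\in E$, that contains $(f,I_x(f))$ for $f\in L$ and that, for every monotone sequence of functions $f_n$ with pointwise limit $f:\mathbb R\to\mathbb R$ and $(f_n,y_n)\in M(I_x)$, contains $(f,\sup_n y_n)$ if $f_n\uparrow f$ and $\sup_n y_n$ exists in $E$, and $(f,\inf_n y_n)$ if $f_n\downarrow f$ and $\inf_n y_n$ exists in $E$. We say that $f(x)$ is defined with value $a\in E^s$, for $f:\mathbb R\to(-\infty,+\infty]$, if there are $(f_n,y_n)\in M(I_x)$ with $f_n\uparrow f$ pointwise and $a=\sup_n y_n$. For $f\in L_2(I_x)$ this holds with $a=I_x(f)$. **Theorem.** 1. If $f,g\in L_2(I_x)$ and $f,g\ge 0$, then $(fg)(x)$ is defined, its value is unique, and $(fg)(x)=f(x)\,g(x)$ (where $0\cdot\infty=0$ in the pointwise product). 2. If $g\in L_1(I_x)$ and $f\in L_2(I_{g(x)})$, then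 $(f\circ g)(x)$ is defined, its value is unique, and $(f\circ g)(x)=f(g(x))\in E^s$, where $f(g(x))=I_{g(x)}(f)$. -/

import Mathlib

open Set

/-- `e` is a weak order unit: `e ≥ 0` and only `0` is disjoint from `e`. -/
def IsWeakOrderUnit {E : Type*} [AddCommGroup E] [Lattice E] (e : E) : Prop :=
  0 ≤ e ∧ ∀ y : E, e ⊓ |y| = 0 → y = 0

/-- An order closed lower set of `E`: every element of `E` that is the supremum in `E` of a
nonempty subset of `A` is in `A`. -/
def IsOrderClosedLower {E : Type*} [PartialOrder E] (A : Set E) : Prop :=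
  IsLowerSet A ∧ ∀ B ⊆ A, B.Nonempty → ∀ b, IsLUB B b → b ∈ A

/-- The sup-completion `E^s` of a Dedekind complete Riesz space `E`. An element `a` of `E^s` is
given by the nonempty order closed lower set `{z ∈ E | z ≤ a}`. -/
@[ext] structure SupCompletion (E : Type*) [PartialOrder E] where
  carrier : Set E
  nonempty' : carrier.Nonempty
  closed' : IsOrderClosedLower carrier

namespace SupCompletion

/-- The order of `E^s`. -/
instance {E : Type*} [PartialOrder E] : PartialOrder (SupCompletion E) :=
  PartialOrder.lift SupCompletion.carrier (fun _ _ h => SupCompletion.ext h)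

/-- The embedding of `E` into `E^s`. -/
def of {E : Type*} [PartialOrder E] (x : E) : SupCompletion E where
  carrier := Iic x
  nonempty' := ⟨x, le_refl x⟩
  closed' := ⟨isLowerSet_Iic x, fun _ hB _ _ hb => hb.2 fun _ hz => hB hz⟩

/-- The supremum in `E^s` of a nonempty set `S` of elements of `E`. -/
def sup {E : Type*} [PartialOrder E] (S : Set E) (hS : S.Nonempty) : SupCompletion E where
  carrier := {z | ∀ A : Set E, IsOrderClosedLower A → S ⊆ A → z ∈ A}
  nonempty' := let ⟨s, hs⟩ := hS; ⟨s, fun _ _ h => h hs⟩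
  closed' := ⟨fun _ _ hyx hx A hA hSA => hA.1 hyx (hx A hA hSA),
    fun _ hB hne b hb A hA hSA => hA.2 _ (fun _ hz => hB hz A hA hSA) hne b hb⟩

/-- `sup S` is the least upper bound of `S` in `E^s`. -/
theorem isLUB_sup {E : Type*} [PartialOrder E] (S : Set E) (hS : S.Nonempty) :
    IsLUB (of '' S) (sup S hS) := by
  constructor
  · rintro _ ⟨s, hs, rfl⟩ z hz A hA hSA
    exact hA.1 hz (hSA hs)
  · intro a ha z hz
    exact hz a.carrier a.closed' fun s hs => ha (mem_image_of_mem of hs) (le_refl s)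

/-- The difference `a - y` of `a ∈ E^s` and `y ∈ E`. -/
def subElem {E : Type*} [AddCommGroup E] [PartialOrder E] [IsOrderedAddMonoid E]
    (a : SupCompletion E) (y : E) : SupCompletion E where
  carrier := {z | z + y ∈ a.carrier}
  nonempty' := let ⟨w, hw⟩ := a.nonempty'; ⟨w - y, by simpa using hw⟩
  closed' := by
    refine ⟨fun z w hwz hz => a.closed'.1 (by gcongr) hz, fun B hB hne b hb => ?_⟩
    refine a.closed'.2 ((OrderIso.addRight y) '' B) ?_ (hne.image _) _
      ((OrderIso.addRight y).isLUB_image'.2 hb)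
    rintro _ ⟨z, hz, rfl⟩
    exact hB hz

/-- The product of two positive elements `a`, `b` of `E^s` (only used for `a, b ≥ 0`), for the
multiplication with unit `e`. Positive multiples `α p`, `β q` of components `p`, `q` of `e`
multiply as `(α p)(β q) = α β (p ∧ q)`; every positive element of `E^s` is the supremum of the
elements `α p` below it, and the product is the supremum of the products of these.
(Inserting `0`, which is `0 e · 0 e`, changes nothing for `a, b ≥ 0`.) -/
def mul {E : Type*} [AddCommGroup E] [Lattice E] [Module ℝ E] (e : E)
    (a b : SupCompletion E) : SupCompletion E :=
  sup (insert 0 {z | ∃ (α β : ℝ) (p q : E), 0 ≤ α ∧ 0 ≤ β ∧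
      p ⊓ (e - p) = 0 ∧ q ⊓ (e - q) = 0 ∧
      α • p ∈ a.carrier ∧ β • q ∈ b.carrier ∧ z = (α * β) • (p ⊓ q)}) (insert_nonempty _ _)

end SupCompletion

section Calculus

variable {E : Type*} [AddCommGroup E] [ConditionallyCompleteLattice E] [Module ℝ E]

/-- `P_u e = sup_n (e ∧ n u)` for `u ≥ 0`: the band projection of `e` on the band of `u`. -/
noncomputable def bandProjUnit (e u : E) : E := sSup (range fun n : ℕ => e ⊓ n • u)

/-- The spectral system `e_t = P_{x ≤ te} e = e - P_{(x - te)⁺} e`, with `e_{-∞} = 0`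
and `e_{+∞} = e`. -/
noncomputable def spectralSystem (e x : E) (t : EReal) : E :=
  if t = ⊥ then 0 else if t = ⊤ then e
  else e - bandProjUnit e ((x - t.toReal • e) ⊔ 0)

open Classical in
/-- `f` is an `𝓕(ℝ)`-step function, i.e. a finite linear combination of indicator functions of
intervals `(a, b] ∩ ℝ` with `-∞ ≤ a ≤ b ≤ +∞`, and `I_x(f) = y`, where
`I_x(1_{(a, b]}) = e_b - e_a`. -/
def HasStepIntegral (e x : E) (f : ℝ → ℝ) (y : E) : Prop :=
  ∃ (n : ℕ) (α : Fin n → ℝ) (a b : Fin n → EReal), (∀ i, a i ≤ b i) ∧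
    (∀ t : ℝ, f t = ∑ i, if a i < (t : EReal) ∧ (t : EReal) ≤ b i then α i else 0) ∧
    y = ∑ i, α i • (spectralSystem e x (b i) - spectralSystem e x (a i))

/-- `f` is the pointwise limit of an increasing sequence of functions `u n` with `R (u n) (y n)`
and `a = sup_n y n` in `E^s`. -/
def IsIncreasingLimit (R : (ℝ → ℝ) → E → Prop) (f : ℝ → EReal) (a : SupCompletion E) : Prop :=
  ∃ (u : ℕ → ℝ → ℝ) (y : ℕ → E), (∀ n, R (u n) (y n)) ∧ Monotone u ∧
    (∀ t, IsLUB (range fun n => (u n t : EReal)) (f t)) ∧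
    a = SupCompletion.sup (range y) (range_nonempty y)

/-- `f ∈ L^↑(I_x)` and `I_x(f) = a`. -/
def HasUpIntegral (e x : E) (f : ℝ → EReal) (a : SupCompletion E) : Prop :=
  IsIncreasingLimit (HasStepIntegral e x) f a

/-- `f ∈ L_1^↑(I_x)` (real-valued, positive, with integral in `E`) and `I_x(f) = y`. -/
def HasL1UpIntegral (e x : E) (f : ℝ → ℝ) (y : E) : Prop :=
  (∀ t, 0 ≤ f t) ∧ HasUpIntegral e x (fun t => (f t : EReal)) (SupCompletion.of y)

/-- `f ∈ L_1(I_x) = L_1^↑(I_x) - L_1^↑(I_x)` and `f(x) = I_x(f) = y`. -/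
def HasL1Integral (e x : E) (f : ℝ → ℝ) (y : E) : Prop :=
  ∃ (u v : ℝ → ℝ) (a b : E), HasL1UpIntegral e x u a ∧ HasL1UpIntegral e x v b ∧
    (∀ t, f t = u t - v t) ∧ y = a - b

/-- `f ∈ L_2(I_x) = L^↑(I_x)₊ - L_1(I_x)` and `f(x) = I_x(f) = a`. -/
def HasL2Integral [IsOrderedAddMonoid E] (e x : E) (f : ℝ → EReal) (a : SupCompletion E) : Prop :=
  ∃ (u : ℝ → EReal) (v : ℝ → ℝ) (c : SupCompletion E) (y : E),
    (∀ t, 0 ≤ u t) ∧ HasUpIntegral e x u c ∧ HasL1Integral e x v y ∧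
    (∀ t, f t = u t - (v t : EReal)) ∧ a = c.subElem y

/-- The closure of `I_x` on step functions under monotone limits of sequences of real-valued
functions whose integrals have a supremum (respectively an infimum) in `E`. -/
inductive HasMonotoneIntegral (e x : E) : (ℝ → ℝ) → E → Prop
  | step (f : ℝ → ℝ) (y : E) : HasStepIntegral e x f y → HasMonotoneIntegral e x f y
  | up (u : ℕ → ℝ → ℝ) (y : ℕ → E) (f : ℝ → ℝ) (a : E) :
      (∀ n, HasMonotoneIntegral e x (u n) (y n)) → Monotone u →
      (∀ t, IsLUB (range fun n => u n t) (f t)) → IsLUB (range y) a →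
      HasMonotoneIntegral e x f a
  | down (u : ℕ → ℝ → ℝ) (y : ℕ → E) (f : ℝ → ℝ) (a : E) :
      (∀ n, HasMonotoneIntegral e x (u n) (y n)) → Antitone u →
      (∀ t, IsGLB (range fun n => u n t) (f t)) → IsGLB (range y) a →
      HasMonotoneIntegral e x f a

/-- `f` is in the domain of the monotone extension of the Daniell integral `I_x` to functions
with values in `(-∞, +∞]`, with integral `f(x) = a` in `E^s`. It extends the integral on
`L_2(I_x)`, see `HasL2Integral.hasExtIntegral`. -/
def HasExtIntegral (e x : E) (f : ℝ → EReal) (a : SupCompletion E) : Prop :=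
  IsIncreasingLimit (HasMonotoneIntegral e x) f a

end Calculus

section Extension

variable {E : Type*} [AddCommGroup E] [ConditionallyCompleteLattice E] [Module ℝ E]

theorem SupCompletion.isLUB_of_of_eq_sup {E : Type*} [PartialOrder E] {y : ℕ → E} {a : E}
    (h : SupCompletion.of a = SupCompletion.sup (range y) (range_nonempty y)) :
    IsLUB (range y) a := by
  have H := SupCompletion.isLUB_sup (range y) (range_nonempty y)
  rw [← h] at H
  constructor
  · intro z hz
    exact H.1 (mem_image_of_mem _ hz) (le_refl z)
  · intro b hb
    have : SupCompletion.of a ≤ SupCompletion.of b := H.2 (by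
      rintro _ ⟨z, hz, rfl⟩ w hw
      exact le_trans hw (hb hz))
    exact this (le_refl a)

theorem SupCompletion.sup_subElem {E : Type*} [AddCommGroup E] [PartialOrder E]
    [IsOrderedAddMonoid E] {y : ℕ → E} (b : E) :
    (SupCompletion.sup (range y) (range_nonempty y)).subElem b =
      SupCompletion.sup (range fun n => y n - b) (range_nonempty _) := by
  have key : ∀ (c : E) (A : Set E), IsOrderClosedLower A → IsOrderClosedLower {z | z + c ∈ A} := by
    intro c A hA
    refine ⟨fun z w hwz hz => hA.1 (by gcongr) hz, fun B hB hne d hd => ?_⟩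
    refine hA.2 ((OrderIso.addRight c) '' B) ?_ (hne.image _) _
      ((OrderIso.addRight c).isLUB_image'.2 hd)
    rintro _ ⟨z, hz, rfl⟩
    exact hB hz
  ext z
  constructor
  · intro hz A hA hS
    have := hz {w | w + (-b) ∈ A} (key _ A hA) (by
      rintro _ ⟨n, rfl⟩
      have := hS ⟨n, rfl⟩
      simpa [sub_eq_add_neg] using this)
    simpa using this
  · intro hz A hA hS
    exact hz {w | w + b ∈ A} (key _ A hA) (by
      rintro _ ⟨n, rfl⟩
      have := hS ⟨n, rfl⟩
      simpa using this)

theorem HasStepIntegral.sub {e x : E} {f g : ℝ → ℝ} {a b : E} (hf : HasStepIntegral e x f a)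
    (hg : HasStepIntegral e x g b) : HasStepIntegral e x (fun t => f t - g t) (a - b) := by
  obtain ⟨n, α, l, r, h1, h2, rfl⟩ := hf
  obtain ⟨m, β, l', r', h1', h2', rfl⟩ := hg
  refine ⟨n + m, Fin.append α (fun i => - β i), Fin.append l l', Fin.append r r', ?_, ?_, ?_⟩
  · intro i
    refine Fin.addCases (fun i => ?_) (fun i => ?_) i
    · simpa using h1 i
    · simpa using h1' i
  · intro t
    change f t - g t = _
    rw [h2, h2', Fin.sum_univ_add]
    simp only [Fin.append_left, Fin.append_right, sub_eq_add_neg, ← Finset.sum_neg_distrib]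
    congr 1
    refine Finset.sum_congr rfl fun i _ => ?_
    split_ifs <;> simp
  · rw [Fin.sum_univ_add]
    simp only [Fin.append_left, Fin.append_right, sub_eq_add_neg, neg_smul,
      Finset.sum_neg_distrib]

theorem isLUB_range_sub {G : Type*} [AddCommGroup G] [PartialOrder G] [IsOrderedAddMonoid G]
    {y : ℕ → G} {a : G} (c : G) (h : IsLUB (range y) a) :
    IsLUB (range fun n => y n - c) (a - c) := by
  have := (OrderIso.addRight (-c)).isLUB_image'.2 h
  rw [← range_comp] at this
  simpa [Function.comp_def, sub_eq_add_neg] using this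

theorem isGLB_range_sub {G : Type*} [AddCommGroup G] [PartialOrder G] [IsOrderedAddMonoid G]
    {y : ℕ → G} {a : G} (c : G) (h : IsGLB (range y) a) :
    IsGLB (range fun n => y n - c) (a - c) := by
  have := (OrderIso.addRight (-c)).isGLB_image'.2 h
  rw [← range_comp] at this
  simpa [Function.comp_def, sub_eq_add_neg] using this

theorem isGLB_range_const_sub {G : Type*} [AddCommGroup G] [PartialOrder G]
    [IsOrderedAddMonoid G] {y : ℕ → G} {a : G} (c : G) (h : IsLUB (range y) a) :
    IsGLB (range fun n => c - y n) (c - a) := by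
  constructor
  · rintro _ ⟨n, rfl⟩
    exact sub_le_sub_left (h.1 ⟨n, rfl⟩) c
  · intro d hd
    have : a ≤ c - d := h.2 (by
      rintro _ ⟨n, rfl⟩
      exact le_sub_comm.1 (hd ⟨n, rfl⟩))
    exact le_sub_comm.1 this

theorem isLUB_range_const_sub {G : Type*} [AddCommGroup G] [PartialOrder G]
    [IsOrderedAddMonoid G] {y : ℕ → G} {a : G} (c : G) (h : IsGLB (range y) a) :
    IsLUB (range fun n => c - y n) (c - a) := by
  constructor
  · rintro _ ⟨n, rfl⟩
    exact sub_le_sub_left (h.1 ⟨n, rfl⟩) c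
  · intro d hd
    have : c - d ≤ a := h.2 (by
      rintro _ ⟨n, rfl⟩
      exact sub_le_comm.1 (hd ⟨n, rfl⟩))
    exact sub_le_comm.1 this

theorem HasMonotoneIntegral.sub [IsOrderedAddMonoid E] {e x : E} {f g : ℝ → ℝ} {a b : E}
    (hf : HasMonotoneIntegral e x f a) (hg : HasMonotoneIntegral e x g b) :
    HasMonotoneIntegral e x (fun t => f t - g t) (a - b) := by
  induction hf generalizing g b with
  | step f y h =>
    induction hg with
    | step g z h' => exact .step _ _ (h.sub h')
    | up u z g b _ hm hl hb ih =>
      exact .down _ _ _ _ ih (fun i j hij t => sub_le_sub_left (hm hij t) _)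
        (fun t => isGLB_range_const_sub _ (hl t)) (isGLB_range_const_sub _ hb)
    | down u z g b _ hm hl hb ih =>
      exact .up _ _ _ _ ih (fun i j hij t => sub_le_sub_left (hm hij t) _)
        (fun t => isLUB_range_const_sub _ (hl t)) (isLUB_range_const_sub _ hb)
  | up u y f a _ hm hl ha ih =>
    exact .up _ _ _ _ (fun n => ih n hg) (fun i j hij t => sub_le_sub_right (hm hij t) _)
      (fun t => isLUB_range_sub _ (hl t)) (isLUB_range_sub _ ha)
  | down u y f a _ hm hl ha ih =>
    exact .down _ _ _ _ (fun n => ih n hg) (fun i j hij t => sub_le_sub_right (hm hij t) _)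
      (fun t => isGLB_range_sub _ (hl t)) (isGLB_range_sub _ ha)

theorem HasL1UpIntegral.hasMonotoneIntegral {e x : E} {f : ℝ → ℝ} {a : E}
    (hf : HasL1UpIntegral e x f a) : HasMonotoneIntegral e x f a := by
  obtain ⟨-, u, y, hu, hm, hl, ha⟩ := hf
  refine .up u y f a (fun n => .step _ _ (hu n)) hm (fun t => ?_)
    (SupCompletion.isLUB_of_of_eq_sup ha)
  constructor
  · rintro _ ⟨n, rfl⟩
    exact EReal.coe_le_coe_iff.1 ((hl t).1 ⟨n, rfl⟩)
  · intro b hb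
    refine EReal.coe_le_coe_iff.1 ((hl t).2 ?_)
    rintro _ ⟨n, rfl⟩
    exact EReal.coe_le_coe_iff.2 (hb ⟨n, rfl⟩)

/-- The monotone extension of `I_x` extends `I_x` on `L_2(I_x)`. -/
theorem HasL2Integral.hasExtIntegral [IsOrderedAddMonoid E] {e x : E} {f : ℝ → EReal}
    {a : SupCompletion E}
    (hf : HasL2Integral e x f a) : HasExtIntegral e x f a := by
  obtain ⟨u, v, c, y, -, ⟨s, z, hs, hm, hl, rfl⟩, ⟨v₁, v₂, b₁, b₂, h₁, h₂, hv, rfl⟩, hf, rfl⟩ := hf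
  have hV := h₁.hasMonotoneIntegral.sub h₂.hasMonotoneIntegral
  have hv' : v = fun t => v₁ t - v₂ t := funext hv
  rw [← hv'] at hV
  refine ⟨fun n t => s n t - v t, fun n => z n - (b₁ - b₂),
    fun n => (HasMonotoneIntegral.step _ _ (hs n)).sub hV,
    fun i j hij t => sub_le_sub_right (hm hij t) _, fun t => ?_, SupCompletion.sup_subElem _⟩
  rw [hf t]
  constructor
  · rintro _ ⟨n, rfl⟩
    simp only [EReal.coe_sub]
    exact EReal.sub_le_sub ((hl t).1 ⟨n, rfl⟩) le_rfl
  · intro d hd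
    rw [EReal.sub_le_iff_le_add (by simp) (by simp)]
    refine (hl t).2 ?_
    rintro _ ⟨n, rfl⟩
    have h := hd ⟨n, rfl⟩
    simp only [EReal.coe_sub] at h
    rwa [EReal.sub_le_iff_le_add (by simp) (by simp)] at h

end Extension

/-! Up to negligible sets of points, `E` behaves like a space of real functions in which `e` is the
constant 1 and `f(x)` is composition. Once this is known, both claims become pointwise statements
about numbers.

The points are filters `I` of positive elements of `E`. A positive `p` forces `y ≥ 0` when `p` is
disjoint from `y⁻`, and `y` has the value `r` at `I` when, for every `ε > 0`, members of `I` force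
`(r - ε)e ≤ y ≤ (r + ε)e`. Since `E` is Archimedean and `e` is a weak order unit, the elements that
decide such questions are dense. Hence every filter meeting suitable countably many dense sets gives
a value to a given `y`, and evaluation respects linear operations, lattice operations and those
countable suprema that exist in `E`. "Almost everywhere" is `∀ᶠ I in generic E`; it survives
countable intersections. By the Rasiowa–Sikorski lemma every `p > 0` lies in a generic filter, so
the order of `E` can be read off from values (`le_iff_eventually_value_le`).

The spectral element at `t` has value 1 where `x` has value at most `t`, and 0 elsewhere. Induction
over monotone limits then shows that the integral of `f` has value `f (value x)`
(`HasMonotoneIntegral.eventually_value_eq`). In `E^s`, `z ≤ f(x)` means that the value of `z` is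
generically at most `f (value x)` (`HasExtIntegral.mem_carrier_iff`); this gives uniqueness and,
through rational level sets, the product formula. Existence holds because the monotone closure
contains all Borel simple functions. -/

open Filter Order

/-! ### Forcing positivity on a band, and the density arguments. -/

section Riesz

variable {E : Type*} [AddCommGroup E] [ConditionallyCompleteLattice E]

/-- `y` is positive on the band generated by the positive element `p`. -/
def ForcesNonneg (p y : E) : Prop := p ⊓ y⁻ ≤ 0

namespace ForcesNonneg

variable {p q y z : E}

theorem neg_iff : ForcesNonneg p (-y) ↔ p ⊓ y⁺ ≤ 0 := by
  rw [ForcesNonneg, negPart_neg]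

theorem anti (h : ForcesNonneg p y) (hq : q ≤ p) : ForcesNonneg q y :=
  (inf_le_inf_right _ hq).trans h

variable [IsOrderedAddMonoid E]

theorem mono (h : ForcesNonneg p y) (hy : y ≤ z) : ForcesNonneg p z :=
  (inf_le_inf_left _ (negPart_anti hy)).trans h

theorem of_nonneg (h : 0 ≤ y) : ForcesNonneg p y := by
  rw [ForcesNonneg, negPart_eq_zero.2 h]
  exact inf_le_right

/-- The part `w` of `(y + z)⁻` below `p` is at most `y⁻ + z⁻`. Then `w - z⁻` lies below `p ⊓ y⁻ ≤
0`, so `w ≤ p ⊓ z⁻ ≤ 0`. -/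
theorem add (hy : ForcesNonneg p y) (hz : ForcesNonneg p z) : ForcesNonneg p (y + z) := by
  have h1 : (y + z)⁻ ≤ y⁻ + z⁻ := by
    refine sup_le ?_ (add_nonneg (negPart_nonneg _) (negPart_nonneg _))
    rw [neg_add]
    exact add_le_add (neg_le_negPart _) (neg_le_negPart _)
  set w := p ⊓ (y + z)⁻ with hw
  have hwp : w ≤ p := inf_le_left
  have hw2 : w ≤ y⁻ + z⁻ := inf_le_right.trans h1
  have h3 : w - z⁻ ≤ p ⊓ y⁻ :=
    le_inf ((sub_le_self _ (negPart_nonneg _)).trans hwp) (sub_le_iff_le_add.2 hw2)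
  have h4 : w ≤ z⁻ := sub_nonpos.1 (h3.trans hy)
  exact (le_inf hwp h4).trans hz

theorem inf (hy : ForcesNonneg p y) (hz : ForcesNonneg p z) : ForcesNonneg p (y ⊓ z) := by
  have h1 : (y ⊓ z)⁻ ≤ y⁻ + z⁻ := by
    refine sup_le ?_ (add_nonneg (negPart_nonneg _) (negPart_nonneg _))
    rw [neg_inf]
    exact sup_le ((neg_le_negPart _).trans (le_add_of_nonneg_right (negPart_nonneg _)))
      ((neg_le_negPart _).trans (le_add_of_nonneg_left (negPart_nonneg _)))
  have h3 : ForcesNonneg p (-(y⁻ + z⁻)) := by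
    have hy' : ForcesNonneg p (-y⁻) := by
      rw [ForcesNonneg, negPart_neg, posPart_eq_self.2 (negPart_nonneg _)]; exact hy
    have hz' : ForcesNonneg p (-z⁻) := by
      rw [ForcesNonneg, negPart_neg, posPart_eq_self.2 (negPart_nonneg _)]; exact hz
    rw [neg_add]
    exact hy'.add hz'
  refine h3.mono ?_
  rw [neg_le]
  exact (neg_le_negPart _).trans h1

theorem posPart_self (y : E) : ForcesNonneg y⁺ y := by
  rw [ForcesNonneg, posPart_inf_negPart_eq_zero]

/-- Below every `p > 0` that does not force `-y ≥ 0` there is `q > 0` that forces `y ≥ 0`. -/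
theorem exists_of_not_neg (hp : 0 ≤ p) (h : ¬ ForcesNonneg p (-y)) :
    ∃ q, 0 < q ∧ q ≤ p ∧ ForcesNonneg q y := by
  rw [neg_iff] at h
  refine ⟨p ⊓ y⁺, ?_, inf_le_left, (posPart_self y).anti inf_le_right⟩
  exact lt_of_le_of_ne (le_inf hp (posPart_nonneg _)) fun h' => h h'.ge

/-- If `0 ≤ u` and `p` forces `w ≤ 0`, where `w ≤ u`, then `w ≤ u - u ⊓ p`. -/
theorem le_sub_inf {u w : E} (hu : 0 ≤ u) (hwu : w ≤ u) (hp : 0 ≤ p)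
    (h : ForcesNonneg p (-w)) : w ≤ u - u ⊓ p := by
  rw [neg_iff] at h
  have h0 : (u ⊓ p) ⊓ w⁺ = 0 :=
    le_antisymm ((inf_le_inf_right _ inf_le_right).trans h)
      (le_inf (le_inf hu hp) (posPart_nonneg _))
  -- Disjoint elements have their supremum as sum, and both of these lie below `u`.
  have h1 : (u ⊓ p) + w⁺ = (u ⊓ p) ⊔ w⁺ := by
    rw [← inf_add_sup, h0, zero_add]
  rw [le_sub_iff_add_le]
  calc w + u ⊓ p ≤ w⁺ + u ⊓ p := by gcongr; exact le_posPart _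
    _ = (u ⊓ p) ⊔ w⁺ := by rw [add_comm, h1]
    _ ≤ u := sup_le inf_le_left (sup_le hwu hu)

/-- Dedekind completeness implies the Archimedean property: if `s` is the supremum of the multiples
of `z`, then `s - z` is again an upper bound. -/
theorem _root_.nonpos_of_forall_nsmul_le {y z : E} (h : ∀ n : ℕ, n • z ≤ y) : z ≤ 0 := by
  have hl : IsLUB (range fun n : ℕ => n • z) (sSup (range fun n : ℕ => n • z)) :=
    isLUB_csSup (range_nonempty _) ⟨y, by rintro _ ⟨n, rfl⟩; exact h n⟩
  have : sSup (range fun n : ℕ => n • z) ≤ sSup (range fun n : ℕ => n • z) - z := by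
    refine hl.2 ?_
    rintro _ ⟨n, rfl⟩
    have := hl.1 ⟨n + 1, rfl⟩
    simp only [succ_nsmul] at this
    exact le_sub_iff_add_le.2 this
  simpa using this

variable [Module ℝ E] [IsOrderedModule ℝ E]

theorem smul (hp : 0 ≤ p) (hy : ForcesNonneg p y) {c : ℝ} (hc : 0 ≤ c) :
    ForcesNonneg p (c • y) := by
  have h1 : (c • y)⁻ ≤ c • y⁻ := by
    refine sup_le ?_ (smul_nonneg hc (negPart_nonneg _))
    rw [← smul_neg]
    exact smul_le_smul_of_nonneg_left (neg_le_negPart _) hc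
  -- Dividing by `max c 1` brings `w` below `y⁻` (as `c ≤ max c 1`) and keeps it below `p` (as `1 ≤
  -- max c 1`).
  have hm : 0 < max c 1 := lt_max_of_lt_right one_pos
  set w := p ⊓ (c • y)⁻
  have hw : 0 ≤ w := le_inf hp (negPart_nonneg _)
  have h2 : (max c 1)⁻¹ • w ≤ p := by
    calc (max c 1)⁻¹ • w ≤ (1 : ℝ) • w :=
          smul_le_smul_of_nonneg_right (inv_le_one_of_one_le₀ (le_max_right _ _)) hw
      _ ≤ p := by rw [one_smul]; exact inf_le_left
  have h3 : (max c 1)⁻¹ • w ≤ y⁻ := by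
    calc (max c 1)⁻¹ • w ≤ (max c 1)⁻¹ • (c • y⁻) :=
          smul_le_smul_of_nonneg_left (inf_le_right.trans h1) (inv_nonneg.2 hm.le)
      _ = ((max c 1)⁻¹ * c) • y⁻ := smul_smul _ _ _
      _ ≤ (1 : ℝ) • y⁻ := by
          refine smul_le_smul_of_nonneg_right ?_ (negPart_nonneg _)
          rw [inv_mul_le_one₀ hm]
          exact le_max_left _ _
      _ = y⁻ := one_smul _ _
  have h4 := (le_inf h2 h3).trans hy
  have h5 := smul_le_smul_of_nonneg_left h4 hm.le
  rwa [smul_smul, mul_inv_cancel₀ hm.ne', one_smul, smul_zero] at h5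

theorem nonpos_of_neg_smul {e : E} (he : IsWeakOrderUnit e) (hp : 0 ≤ p) {ε : ℝ} (hε : 0 < ε)
    (h : ForcesNonneg p (-(ε • e))) : p ≤ 0 := by
  have h1 : ForcesNonneg p (-e) := by
    have := h.smul hp (inv_nonneg.2 hε.le)
    rwa [smul_neg, smul_smul, inv_mul_cancel₀ hε.ne', one_smul] at this
  rw [neg_iff, posPart_eq_self.2 he.1] at h1
  refine (he.2 p ?_).le
  rw [abs_of_nonneg hp, inf_comm]
  exact le_antisymm h1 (le_inf hp he.1)

/-- Otherwise `p` forces `u i ≤ a - ε e` for all `i`, so `a - (ε e ⊓ p)` is still an upper bound.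
This makes `p` disjoint from `ε e`, against the weak order unit property. -/
theorem exists_of_isLUB {e : E} (he : IsWeakOrderUnit e) {ι : Type*} {u : ι → E} {a : E}
    (ha : IsLUB (range u) a) {ε : ℝ} (hε : 0 < ε) (hp : 0 < p) :
    ∃ q, 0 < q ∧ q ≤ p ∧ ∃ i, ForcesNonneg q (u i - a + ε • e) := by
  by_contra! H
  have h1 : ∀ i, ForcesNonneg p (-(u i - a + ε • e)) := by
    intro i
    by_contra h
    obtain ⟨q, hq, hqp, hf⟩ := exists_of_not_neg hp.le h
    exact H q hq hqp i hf
  have hεe : 0 ≤ ε • e := smul_nonneg hε.le he.1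
  have h2 : a ≤ a - (ε • e) ⊓ p := by
    refine ha.2 ?_
    rintro _ ⟨i, rfl⟩
    have h3 := le_sub_inf hεe (by simpa using ha.1 ⟨i, rfl⟩) hp.le (h1 i)
    have h4 := add_le_add_left h3 (a - ε • e)
    have e1 : u i - a + ε • e + (a - ε • e) = u i := by abel
    have e2 : ε • e - ε • e ⊓ p + (a - ε • e) = a - ε • e ⊓ p := by abel
    rwa [e1, e2] at h4
  have h3 : (ε • e) ⊓ p ≤ 0 := by simpa using h2
  have h4 : ForcesNonneg p (-(ε • e)) := by
    rw [neg_iff, posPart_eq_self.2 hεe, inf_comm]; exact h3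
  exact hp.not_ge (nonpos_of_neg_smul he hp.le hε h4)

/-- Every element is locally bounded by a multiple of `e`. Otherwise `p` forces `n e ≤ y` for all
`n`, whence `n (e ⊓ p) ≤ y⁺`, and the Archimedean property makes `p` disjoint from `e`. -/
theorem exists_nat_smul_sub {e : E} (he : IsWeakOrderUnit e) (hp : 0 < p) (y : E) :
    ∃ q, 0 < q ∧ q ≤ p ∧ ∃ n : ℕ, ForcesNonneg q ((n : ℝ) • e - y) := by
  by_contra! H
  have h1 : ∀ n : ℕ, ForcesNonneg p (-((n : ℝ) • e - y)) := by
    intro n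
    by_contra h
    obtain ⟨q, hq, hqp, hf⟩ := exists_of_not_neg hp.le h
    exact H q hq hqp n hf
  have h2 : ∀ n : ℕ, n • (e ⊓ p) ≤ y⁺ := by
    intro n
    have hne : 0 ≤ (n : ℝ) • e := smul_nonneg n.cast_nonneg he.1
    have h3 : ForcesNonneg ((n : ℝ) • (e ⊓ p)) (-((n : ℝ) • e - y⁺)) := by
      have h4 : ForcesNonneg (e ⊓ p) (-((n : ℝ) • e - y⁺)) :=
        ((h1 n).mono (by gcongr; exact le_posPart y)).anti inf_le_right
      rw [neg_iff] at h4 ⊢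
      -- Disjointness is symmetric: exchanging the two roles allows the forcing element `e ⊓ p` to
      -- be scaled by `n`.
      have h5 : ForcesNonneg ((n : ℝ) • e - y⁺)⁺ (-(e ⊓ p)) := by
        rw [neg_iff, posPart_eq_self.2 (le_inf he.1 hp.le), inf_comm]; exact h4
      have h6 := h5.smul (posPart_nonneg _) n.cast_nonneg (c := (n : ℝ))
      rwa [smul_neg, neg_iff, posPart_eq_self.2 (smul_nonneg n.cast_nonneg
        (le_inf he.1 hp.le)), inf_comm] at h6
    have h7 := le_sub_inf hne (sub_le_self _ (posPart_nonneg y))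
      (smul_nonneg n.cast_nonneg (le_inf he.1 hp.le)) h3
    rw [inf_eq_right.2 (smul_le_smul_of_nonneg_left inf_le_left n.cast_nonneg)] at h7
    rw [← Nat.cast_smul_eq_nsmul ℝ]
    have h8 := add_le_add_left h7 ((n : ℝ) • (e ⊓ p) + y⁺ - (n : ℝ) • e)
    have e1 : (n : ℝ) • e - y⁺ + ((n : ℝ) • (e ⊓ p) + y⁺ - (n : ℝ) • e) =
      (n : ℝ) • (e ⊓ p) := by abel
    have e2 : (n : ℝ) • e - (n : ℝ) • (e ⊓ p) + ((n : ℝ) • (e ⊓ p) + y⁺ - (n : ℝ) • e) =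
      y⁺ := by abel
    rwa [e1, e2] at h8
  have h3 := nonpos_of_forall_nsmul_le h2
  have h4 : ForcesNonneg p (-((1 : ℝ) • e)) := by
    rw [one_smul, neg_iff, posPart_eq_self.2 he.1, inf_comm]; exact h3
  exact hp.not_ge (nonpos_of_neg_smul he hp.le one_pos h4)

end ForcesNonneg

end Riesz

/-! ### Generic filters of positive elements. -/

section Generic

variable {E : Type*} [AddCommGroup E] [ConditionallyCompleteLattice E]

/-- The downward directed families of positive elements of `E`, closed under passing to larger
elements. -/
abbrev PosFilter (E : Type*) [AddCommGroup E] [ConditionallyCompleteLattice E] : Type _ :=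
  Order.Ideal {p : E // 0 < p}ᵒᵈ

/-- The filter of the sets of `PosFilter E` that contain all members meeting countably many given
dense sets of positive elements. -/
def generic (E : Type*) [AddCommGroup E] [ConditionallyCompleteLattice E] :
    Filter (PosFilter E) :=
  countableGenerate {S | ∃ D : Cofinal {p : E // 0 < p}ᵒᵈ, S = {I | ∃ p ∈ D, p ∈ I}}

instance : CountableInterFilter (generic E) := by unfold generic; infer_instance

namespace PosFilter

/-- Some member of `I` forces `y ≥ 0`. -/
def Nonneg (I : PosFilter E) (y : E) : Prop :=
  ∃ p : {p : E // 0 < p}, OrderDual.toDual p ∈ I ∧ ForcesNonneg (p : E) y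

/-- Turns a density statement in `E` into a statement that holds at almost every point. -/
theorem eventually_of_dense {Q : PosFilter E → Prop} (P : E → Prop)
    (hP : ∀ p, 0 < p → ∃ q, 0 < q ∧ q ≤ p ∧ P q)
    (hQ : ∀ (I : PosFilter E) (p : {p : E // 0 < p}), OrderDual.toDual p ∈ I → P p → Q I) :
    ∀ᶠ I in generic E, Q I := by
  let D : Cofinal {p : E // 0 < p}ᵒᵈ :=
    ⟨{p | P (OrderDual.ofDual p : {p : E // 0 < p})}, fun p => by
      obtain ⟨q, hq, hqp, h⟩ := hP _ (OrderDual.ofDual p).2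
      exact ⟨OrderDual.toDual ⟨q, hq⟩, h, hqp⟩⟩
  have h1 : {I : PosFilter E | ∃ p ∈ D, p ∈ I} ∈ generic E :=
    mem_countableGenerate_iff.2 ⟨{_}, singleton_subset_iff.2 ⟨D, rfl⟩, countable_singleton _,
      by simp⟩
  filter_upwards [h1] with I ⟨p, hpD, hpI⟩
  exact hQ I (OrderDual.ofDual p) hpI hpD

/-- The Rasiowa–Sikorski lemma: every positive element belongs to some generic family. -/
theorem exists_mem_of_eventually {Q : PosFilter E → Prop} (h : ∀ᶠ I in generic E, Q I)
    (p : {p : E // 0 < p}) : ∃ I : PosFilter E, OrderDual.toDual p ∈ I ∧ Q I := by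
  obtain ⟨S, hS, hc, hSQ⟩ := mem_countableGenerate_iff.1 h
  have hS' : ∀ s ∈ S, ∃ D : Cofinal {p : E // 0 < p}ᵒᵈ, s = {I | ∃ p ∈ D, p ∈ I} := hS
  choose! D hD using hS'
  have := hc.toEncodable
  refine ⟨idealOfCofinals (OrderDual.toDual p) fun s : S => D s, mem_idealOfCofinals _ _,
    hSQ fun s hs => ?_⟩
  rw [hD s hs]
  exact cofinal_meets_idealOfCofinals (OrderDual.toDual p) (fun s : S => D s) ⟨s, hs⟩

variable {I : PosFilter E} {y z : E}

variable [IsOrderedAddMonoid E]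

theorem Nonneg.mono (hy : I.Nonneg y) (h : y ≤ z) : I.Nonneg z :=
  let ⟨p, hp, hf⟩ := hy; ⟨p, hp, hf.mono h⟩

theorem nonneg_of_nonneg (h : 0 ≤ y) : I.Nonneg y := by
  obtain ⟨p, hp⟩ := I.nonempty
  exact ⟨OrderDual.ofDual p, hp, .of_nonneg h⟩

theorem Nonneg.add (hy : I.Nonneg y) (hz : I.Nonneg z) : I.Nonneg (y + z) := by
  obtain ⟨p, hp, h⟩ := hy
  obtain ⟨q, hq, h'⟩ := hz
  obtain ⟨r, hr, hpr, hqr⟩ := I.directed _ hp _ hq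
  exact ⟨OrderDual.ofDual r, hr, (h.anti hpr).add (h'.anti hqr)⟩

theorem Nonneg.inf (hy : I.Nonneg y) (hz : I.Nonneg z) : I.Nonneg (y ⊓ z) := by
  obtain ⟨p, hp, h⟩ := hy
  obtain ⟨q, hq, h'⟩ := hz
  obtain ⟨r, hr, hpr, hqr⟩ := I.directed _ hp _ hq
  exact ⟨OrderDual.ofDual r, hr, (h.anti hpr).inf (h'.anti hqr)⟩

theorem eventually_nonneg_or (y : E) :
    ∀ᶠ I in generic E, I.Nonneg y ∨ I.Nonneg (-y) := by
  refine eventually_of_dense (fun p => ForcesNonneg p y ∨ ForcesNonneg p (-y)) ?_ ?_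
  · intro p hp
    by_cases h : ForcesNonneg p (-y)
    · exact ⟨p, hp, le_rfl, .inr h⟩
    · obtain ⟨q, h1, h2, h3⟩ := ForcesNonneg.exists_of_not_neg hp.le h
      exact ⟨q, h1, h2, .inl h3⟩
  · rintro I p hp (h | h)
    · exact .inl ⟨p, hp, h⟩
    · exact .inr ⟨p, hp, h⟩

/-! ### Real values of elements at generic filters. -/

variable [Module ℝ E]

/-- The element `y` has the value `r` at `I`, where the weak order unit `e` has the value `1`. -/
def HasValue (e : E) (I : PosFilter E) (y : E) (r : ℝ) : Prop :=
  ∀ ε : ℝ, 0 < ε → I.Nonneg (y - (r - ε) • e) ∧ I.Nonneg ((r + ε) • e - y)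

theorem HasValue.add {e : E} {r s : ℝ} (hy : HasValue e I y r) (hz : HasValue e I z s) : HasValue e I (y + z) (r + s) := by
  intro ε hε
  obtain ⟨h1, h2⟩ := hy (ε / 2) (by positivity)
  obtain ⟨h3, h4⟩ := hz (ε / 2) (by positivity)
  have e1 : y + z - (r + s - ε) • e = (y - (r - ε / 2) • e) + (z - (s - ε / 2) • e) := by module
  have e2 : (r + s + ε) • e - (y + z) = ((r + ε / 2) • e - y) + ((s + ε / 2) • e - z) := by
    module
  exact ⟨e1 ▸ h1.add h3, e2 ▸ h2.add h4⟩

variable [IsOrderedModule ℝ E]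

theorem Nonneg.smul (hy : I.Nonneg y) {c : ℝ} (hc : 0 ≤ c) : I.Nonneg (c • y) :=
  let ⟨p, hp, hf⟩ := hy; ⟨p, hp, hf.smul p.2.le hc⟩

/-- No `p > 0` can force a negative multiple of `e` to be positive; this is what makes values unique
and monotone. -/
theorem nonneg_of_nonneg_smul {e : E} (he : IsWeakOrderUnit e) {c : ℝ} (h : I.Nonneg (c • e)) : 0 ≤ c := by
  by_contra! hc
  obtain ⟨p, -, hf⟩ := h
  rw [← neg_neg (c • e), ← neg_smul] at hf
  exact p.2.not_ge (hf.nonpos_of_neg_smul he p.2.le (neg_pos.2 hc))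

namespace HasValue

variable {e : E} {r s : ℝ}

omit [IsOrderedAddMonoid E] [IsOrderedModule ℝ E] in
theorem neg (hy : HasValue e I y r) : HasValue e I (-y) (-r) := by
  intro ε hε
  obtain ⟨h1, h2⟩ := hy ε hε
  have e1 : -y - (-r - ε) • e = (r + ε) • e - y := by module
  have e2 : (-r + ε) • e - -y = y - (r - ε) • e := by module
  exact ⟨e1 ▸ h2, e2 ▸ h1⟩

theorem unit (he : 0 ≤ e) : HasValue e I e 1 := by
  intro ε hε
  have e1 : e - (1 - ε) • e = ε • e := by module
  have e2 : (1 + ε) • e - e = ε • e := by module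
  rw [e1, e2, and_self]
  exact nonneg_of_nonneg (smul_nonneg hε.le he)

theorem zero (he : 0 ≤ e) : HasValue e I 0 0 := by
  intro ε hε
  have e1 : (0 : E) - (0 - ε) • e = ε • e := by module
  have e2 : (0 + ε) • e - 0 = ε • e := by module
  rw [e1, e2, and_self]
  exact nonneg_of_nonneg (smul_nonneg hε.le he)

theorem smul_of_pos (hy : HasValue e I y r) {c : ℝ} (hc : 0 < c) :
    HasValue e I (c • y) (c * r) := by
  intro ε hε
  obtain ⟨h1, h2⟩ := hy (ε / c) (by positivity)
  have e1 : c • y - (c * r - ε) • e = c • (y - (r - ε / c) • e) := by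
    rw [smul_sub, smul_smul, mul_sub, mul_div_cancel₀ _ hc.ne']
  have e2 : (c * r + ε) • e - c • y = c • ((r + ε / c) • e - y) := by
    rw [smul_sub, smul_smul, mul_add, mul_div_cancel₀ _ hc.ne']
  exact ⟨e1 ▸ h1.smul hc.le, e2 ▸ h2.smul hc.le⟩

theorem smul (he : 0 ≤ e) (hy : HasValue e I y r) (c : ℝ) : HasValue e I (c • y) (c * r) := by
  rcases lt_trichotomy c 0 with hc | rfl | hc
  · simpa using (hy.smul_of_pos (neg_pos.2 hc)).neg
  · simpa using zero he
  · exact hy.smul_of_pos hc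

theorem sup (he : 0 ≤ e) (hy : HasValue e I y r) (hz : HasValue e I z s) :
    HasValue e I (y ⊔ z) (max r s) := by
  intro ε hε
  obtain ⟨h1, h2⟩ := hy ε hε
  obtain ⟨h3, h4⟩ := hz ε hε
  constructor
  · rcases le_total r s with h | h
    · rw [max_eq_right h]
      exact h3.mono (sub_le_sub_right le_sup_right _)
    · rw [max_eq_left h]
      exact h1.mono (sub_le_sub_right le_sup_left _)
  · have h5 : (r + ε) • e ≤ (max r s + ε) • e :=
      smul_le_smul_of_nonneg_right (by gcongr; exact le_max_left _ _) he
    have h6 : (s + ε) • e ≤ (max r s + ε) • e :=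
      smul_le_smul_of_nonneg_right (by gcongr; exact le_max_right _ _) he
    refine (h2.inf h4).mono ?_
    rw [le_sub_comm]
    exact sup_le (le_sub_comm.1 (inf_le_left.trans (sub_le_sub_right h5 _)))
      (le_sub_comm.1 (inf_le_right.trans (sub_le_sub_right h6 _)))

theorem le (he : IsWeakOrderUnit e) (hy : HasValue e I y r) (hz : HasValue e I z s)
    (h : I.Nonneg (z - y)) : r ≤ s := by
  refine le_of_forall_pos_le_add fun ε hε => ?_
  have h1 := ((hy (ε / 2) (by positivity)).1.add (hz (ε / 2) (by positivity)).2).add h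
  have e1 : y - (r - ε / 2) • e + ((s + ε / 2) • e - z) + (z - y) = (s + ε - r) • e := by
    module
  rw [e1] at h1
  linarith [nonneg_of_nonneg_smul he h1]

theorem unique (he : IsWeakOrderUnit e) (hy : HasValue e I y r) (hz : HasValue e I y s) :
    r = s :=
  le_antisymm (hy.le he hz (nonneg_of_nonneg (by simp))) (hz.le he hy (nonneg_of_nonneg (by simp)))

end HasValue

/-- The value is the Dedekind cut `sup {c | I forces y ≥ c e}`. Local boundedness of `y` and `-y`
makes the cut finite and nonempty. Deciding `y ≥ q e` for rational `q` suffices, which keeps the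
conditions countable. -/
theorem eventually_exists_hasValue {e : E} (he : IsWeakOrderUnit e) (y : E) :
    ∀ᶠ I in generic E, ∃ r, HasValue e I y r := by
  have hbd : ∀ y : E, ∀ᶠ I in generic E, ∃ n : ℕ, I.Nonneg ((n : ℝ) • e - y) := fun y =>
    eventually_of_dense (fun p => ∃ n : ℕ, ForcesNonneg p ((n : ℝ) • e - y))
      (fun p hp => ForcesNonneg.exists_nat_smul_sub he hp y)
      fun I p hp ⟨n, h⟩ => ⟨n, p, hp, h⟩
  filter_upwards [hbd y, hbd (-y), eventually_countable_forall.2 fun q : ℚ =>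
    eventually_nonneg_or (y - (q : ℝ) • e)] with I ⟨n, hn⟩ ⟨m, hm⟩ hq
  set S : Set ℝ := {c | I.Nonneg (y - c • e)}
  have hb : ∀ c ∈ S, c ≤ n := fun c hc => by
    have h1 := hn.add hc
    have e1 : (n : ℝ) • e - y + (y - c • e) = ((n : ℝ) - c) • e := by module
    rw [e1] at h1
    linarith [nonneg_of_nonneg_smul he h1]
  have hne : S.Nonempty := ⟨-m, by
    have e1 : y - (-m : ℝ) • e = (m : ℝ) • e - -y := by module
    change I.Nonneg _; rw [e1]; exact hm⟩
  refine ⟨sSup S, fun ε hε => ⟨?_, ?_⟩⟩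
  · obtain ⟨c, hc, hlt⟩ := exists_lt_of_lt_csSup hne (sub_lt_self (sSup S) hε)
    exact Nonneg.mono hc (sub_le_sub_left (smul_le_smul_of_nonneg_right hlt.le he.1) _)
  · obtain ⟨q, h1, h2⟩ := exists_rat_btwn (lt_add_of_pos_right (sSup S) hε)
    rcases hq q with h | h
    · exact absurd (le_csSup ⟨(n : ℝ), hb⟩ h) h1.not_ge
    · rw [neg_sub] at h
      exact h.mono (sub_le_sub_right (smul_le_smul_of_nonneg_right h2.le he.1) _)

open Classical in
/-- The value of `y` at `I`. -/
noncomputable def value (e : E) (I : PosFilter E) (y : E) : ℝ :=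
  -- The default 0 is harmless: for a weak order unit `e` it is used only at non-generic `I`.
  if h : ∃ r, HasValue e I y r then h.choose else 0

variable {e : E} (he : IsWeakOrderUnit e)
include he

theorem eventually_hasValue (y : E) : ∀ᶠ I in generic E, HasValue e I y (value e I y) := by
  filter_upwards [eventually_exists_hasValue he y] with I h
  rw [value, dif_pos h]
  exact h.choose_spec

theorem HasValue.value_eq {r : ℝ} (h : HasValue e I y r) : value e I y = r := by
  have h' : ∃ r, HasValue e I y r := ⟨r, h⟩
  rw [value, dif_pos h']
  exact h'.choose_spec.unique he h

theorem value_unit (I : PosFilter E) : value e I e = 1 := (HasValue.unit he.1).value_eq he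

theorem value_zero (I : PosFilter E) : value e I 0 = 0 := (HasValue.zero he.1).value_eq he

theorem value_add (y z : E) :
    ∀ᶠ I in generic E, value e I (y + z) = value e I y + value e I z := by
  filter_upwards [eventually_hasValue he y, eventually_hasValue he z] with I h1 h2
  exact (h1.add h2).value_eq he

theorem value_neg (y : E) : ∀ᶠ I in generic E, value e I (-y) = -value e I y := by
  filter_upwards [eventually_hasValue he y] with I h1
  exact h1.neg.value_eq he

theorem value_sub (y z : E) :
    ∀ᶠ I in generic E, value e I (y - z) = value e I y - value e I z := by
  filter_upwards [eventually_hasValue he y, eventually_hasValue he z] with I h1 h2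
  rw [sub_eq_add_neg, sub_eq_add_neg]
  exact (h1.add h2.neg).value_eq he

theorem value_smul (c : ℝ) (y : E) :
    ∀ᶠ I in generic E, value e I (c • y) = c * value e I y := by
  filter_upwards [eventually_hasValue he y] with I h1
  exact (h1.smul he.1 c).value_eq he

theorem value_sup (y z : E) :
    ∀ᶠ I in generic E, value e I (y ⊔ z) = max (value e I y) (value e I z) := by
  filter_upwards [eventually_hasValue he y, eventually_hasValue he z] with I h1 h2
  exact (h1.sup he.1 h2).value_eq he

theorem value_inf (y z : E) :
    ∀ᶠ I in generic E, value e I (y ⊓ z) = min (value e I y) (value e I z) := by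
  filter_upwards [value_sup he y z, value_sub he (y + z) (y ⊔ z), value_add he y z]
    with I h1 h2 h3
  rw [← inf_add_sup y z, add_sub_cancel_right, inf_add_sup, h3, h1] at h2
  rw [h2, ← min_add_max, add_sub_cancel_right]

theorem value_sum {ι : Type*} (s : Finset ι) (y : ι → E) :
    ∀ᶠ I in generic E, value e I (∑ i ∈ s, y i) = ∑ i ∈ s, value e I (y i) := by
  classical
  induction s using Finset.induction_on with
  | empty => simp [value_zero he]
  | insert i s hi ih =>
    filter_upwards [ih, value_add he (y i) (∑ i ∈ s, y i)] with I h1 h2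
    rw [Finset.sum_insert hi, Finset.sum_insert hi, h2, h1]

/-- Evaluation is faithful. If `y ≤ z` fails, the Archimedean property yields a positive element
forcing `(n + 1)(y - z) ≥ e`, and a generic filter through it separates the values. -/
theorem le_iff_eventually_value_le :
    y ≤ z ↔ ∀ᶠ I in generic E, value e I y ≤ value e I z := by
  constructor
  · intro h
    filter_upwards [eventually_hasValue he y, eventually_hasValue he z] with I h1 h2
    exact h1.le he h2 (nonneg_of_nonneg (sub_nonneg.2 h))
  · intro h
    by_contra hyz
    have h0 : ∃ n : ℕ, ¬ (n + 1) • (y - z) ≤ e := by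
      by_contra! H
      refine hyz (sub_nonpos.1 (nonpos_of_forall_nsmul_le (y := e) fun n => ?_))
      rcases n with _ | n
      · simpa using he.1
      · exact H n
    obtain ⟨n, hn⟩ := h0
    have hpos : 0 < ((n + 1) • (y - z) - e)⁺ := by
      refine lt_of_le_of_ne (posPart_nonneg _) fun h' => hn ?_
      rw [eq_comm, posPart_eq_zero, sub_nonpos] at h'
      exact h'
    have hall : ∀ᶠ I in generic E, value e I y ≤ value e I z ∧
        HasValue e I ((n + 1) • (y - z) - e) ((n + 1) * (value e I y - value e I z) - 1) := by
      filter_upwards [h, eventually_hasValue he y, eventually_hasValue he z] with I h1 h2 h3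
      refine ⟨h1, ?_⟩
      have := ((h2.add h3.neg).smul he.1 (n + 1)).add (HasValue.unit he.1).neg
      have e1 : ((n : ℝ) + 1) • (y + -z) + -e = (n + 1) • (y - z) - e := by
        rw [← Nat.cast_smul_eq_nsmul ℝ]; push_cast; module
      rw [e1] at this
      exact this
    -- At this `I` the value of `y` would exceed that of `z` by at least `1 / (n + 1)`.
    obtain ⟨I, hI, h1, h2⟩ := exists_mem_of_eventually hall ⟨_, hpos⟩
    have h3 := (HasValue.zero he.1).le he h2
      ⟨_, hI, by rw [sub_zero]; exact ForcesNonneg.posPart_self _⟩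
    have : ((n : ℝ) + 1) * (value e I y - value e I z) ≤ 0 :=
      mul_nonpos_of_nonneg_of_nonpos (by positivity) (by linarith)
    linarith

theorem eq_of_eventually_value_eq (h : ∀ᶠ I in generic E, value e I y = value e I z) : y = z :=
  le_antisymm ((le_iff_eventually_value_le he).2 (h.mono fun _ h => h.le))
    ((le_iff_eventually_value_le he).2 (h.mono fun _ h => h.ge))

/-- For each `ε = 1 / (k + 1)` it is dense to force some `u i ≥ a - ε e`; countably many `k` pin
down the supremum. -/
theorem eventually_isLUB_value {ι : Type*} [Countable ι] {u : ι → E} {a : E}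
    (ha : IsLUB (range u) a) :
    ∀ᶠ I in generic E, IsLUB (range fun i => value e I (u i)) (value e I a) := by
  have h1 : ∀ᶠ I in generic E, ∀ k : ℕ, ∃ i, I.Nonneg (u i - a + (1 / ((k : ℝ) + 1)) • e) :=
    eventually_countable_forall.2 fun k =>
      eventually_of_dense (fun p => ∃ i, ForcesNonneg p (u i - a + (1 / ((k : ℝ) + 1)) • e))
        (fun p hp => ForcesNonneg.exists_of_isLUB he ha (by positivity) hp)
        fun I p hp ⟨i, h⟩ => ⟨i, p, hp, h⟩
  filter_upwards [h1, eventually_hasValue he a,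
    eventually_countable_forall.2 fun i => eventually_hasValue he (u i)] with I h1 h2 h3
  constructor
  · rintro _ ⟨i, rfl⟩
    exact (h3 i).le he h2 (nonneg_of_nonneg (sub_nonneg.2 (ha.1 ⟨i, rfl⟩)))
  · intro b hb
    refine le_of_forall_pos_le_add fun ε hε => ?_
    obtain ⟨k, hk⟩ := exists_nat_one_div_lt hε
    obtain ⟨i, hi⟩ := h1 k
    have h4 := (h2.add ((HasValue.unit he.1).smul he.1 (1 / ((k : ℝ) + 1))).neg).le he (h3 i)
      (by convert hi using 1; abel)
    have := hb ⟨i, rfl⟩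
    simp only at this
    linarith

theorem isLUB_of_eventually {ι : Type*} [Countable ι] {u : ι → E} {a : E}
    (h : ∀ᶠ I in generic E, IsLUB (range fun i => value e I (u i)) (value e I a)) :
    IsLUB (range u) a := by
  constructor
  · rintro _ ⟨i, rfl⟩
    exact (le_iff_eventually_value_le he).2 (h.mono fun I hI => hI.1 ⟨i, rfl⟩)
  · intro b hb
    refine (le_iff_eventually_value_le he).2 ?_
    filter_upwards [h, eventually_countable_forall.2 fun i =>
      (le_iff_eventually_value_le he).1 (hb ⟨i, rfl⟩)] with I h1 h2
    exact h1.2 (by rintro _ ⟨i, rfl⟩; exact h2 i)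

theorem eventually_isGLB_value {ι : Type*} [Countable ι] {u : ι → E} {a : E}
    (ha : IsGLB (range u) a) :
    ∀ᶠ I in generic E, IsGLB (range fun i => value e I (u i)) (value e I a) := by
  have h1 : IsLUB (range fun i => -u i) (-a) := by
    have := isLUB_neg.2 (by rwa [neg_neg] : IsGLB (range u) (- -a))
    rwa [← image_neg_eq_neg, ← range_comp] at this
  filter_upwards [eventually_isLUB_value he h1, value_neg he a,
    eventually_countable_forall.2 fun i => value_neg he (u i)] with I h2 h3 h4
  simp only [h3, h4] at h2
  have := isGLB_neg.2 (by rwa [] : IsLUB (range fun i => -value e I (u i)) (-value e I a))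
  rw [← image_neg_eq_neg, ← range_comp] at this
  simpa [Function.comp_def] using this

end PosFilter

end Generic

/-! ### Values of integrals, and Borel functions in the monotone closure. -/

section Integral

open PosFilter

variable {E : Type*} [AddCommGroup E] [ConditionallyCompleteLattice E] [IsOrderedAddMonoid E]
  [Module ℝ E] [IsOrderedModule ℝ E] {e : E} (he : IsWeakOrderUnit e) {x y : E} {f g : ℝ → ℝ}
include he

theorem eventually_value_bandProjUnit {u : E} (hu : 0 ≤ u) :
    ∀ᶠ I in generic E, value e I (bandProjUnit e u) = if 0 < value e I u then 1 else 0 := by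
  have h1 : IsLUB (range fun n : ℕ => e ⊓ n • u) (bandProjUnit e u) :=
    isLUB_csSup (range_nonempty _) ⟨e, by rintro _ ⟨n, rfl⟩; exact inf_le_left⟩
  filter_upwards [eventually_isLUB_value he h1, (le_iff_eventually_value_le he).1 hu,
    eventually_countable_forall.2 fun n : ℕ => value_inf he e (n • u),
    eventually_countable_forall.2 fun n : ℕ => value_smul he (n : ℝ) u] with I h2 h3 h4 h5
  refine h2.unique ?_
  rw [value_zero he] at h3
  have h6 : ∀ n : ℕ, value e I (e ⊓ n • u) = min 1 (n * value e I u) := fun n => by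
    rw [h4, value_unit he, ← h5, Nat.cast_smul_eq_nsmul]
  simp only [h6]
  split_ifs with h
  -- The truncations `min 1 (n v)` reach 1 as soon as `n ≥ 1 / v`.
  · refine ⟨by rintro _ ⟨n, rfl⟩; exact min_le_left _ _, fun b hb => ?_⟩
    obtain ⟨n, hn⟩ := exists_nat_ge (value e I u)⁻¹
    refine le_trans (le_min le_rfl ?_) (hb ⟨n, rfl⟩)
    calc (1 : ℝ) = (value e I u)⁻¹ * value e I u := (inv_mul_cancel₀ h.ne').symm
      _ ≤ _ := by gcongr
  · have h7 : value e I u = 0 := le_antisymm (not_lt.1 h) h3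
    simp [h7]

theorem eventually_value_spectralSystem (x : E) (t : EReal) :
    ∀ᶠ I in generic E,
      value e I (spectralSystem e x t) = if (value e I x : EReal) ≤ t then 1 else 0 := by
  induction t with
  | bot => simp [spectralSystem, value_zero he]
  | top => simp [spectralSystem, value_unit he]
  | coe t =>
    simp only [spectralSystem, EReal.coe_ne_bot, EReal.coe_ne_top, if_false, EReal.toReal_coe,
      EReal.coe_le_coe_iff]
    filter_upwards [value_sub he e (bandProjUnit e ((x - t • e) ⊔ 0)),
      eventually_value_bandProjUnit he (le_sup_right : 0 ≤ (x - t • e) ⊔ 0),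
      value_sup he (x - t • e) 0, value_sub he x (t • e), value_smul he t e] with I h1 h2 h3 h4 h5
    rw [h1, h2, h3, h4, h5, value_unit he, value_zero he]
    by_cases h : value e I x ≤ t
    · simp [h]
    · simp [h]

theorem HasStepIntegral.eventually_value_eq (h : HasStepIntegral e x f y) :
    ∀ᶠ I in generic E, value e I y = f (value e I x) := by
  obtain ⟨n, α, a, b, hab, hf, rfl⟩ := h
  filter_upwards [value_sum he Finset.univ
      fun i => α i • (spectralSystem e x (b i) - spectralSystem e x (a i)),
    eventually_countable_forall.2 fun i =>
      value_smul he (α i) (spectralSystem e x (b i) - spectralSystem e x (a i)),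
    eventually_countable_forall.2 fun i =>
      value_sub he (spectralSystem e x (b i)) (spectralSystem e x (a i)),
    eventually_countable_forall.2 fun i => eventually_value_spectralSystem he x (b i),
    eventually_countable_forall.2 fun i => eventually_value_spectralSystem he x (a i)]
    with I h1 h2 h3 h4 h5
  rw [h1, hf]
  refine Finset.sum_congr rfl fun i _ => ?_
  rw [h2, h3, h4, h5]
  -- As `a i ≤ b i`, the difference of the two half-line indicators is the indicator of the
  -- interval.
  by_cases ha : (value e I x : EReal) ≤ a i
  · simp [ha, ha.trans (hab i), ha.not_gt]
  · by_cases hb : (value e I x : EReal) ≤ b i <;> simp [ha, hb, not_le.1 ha]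

omit he [IsOrderedAddMonoid E] [IsOrderedModule ℝ E] in
theorem HasStepIntegral.measurable (h : HasStepIntegral e x f y) : Measurable f := by
  obtain ⟨n, α, a, b, hab, hf, rfl⟩ := h
  rw [show f = _ from funext hf]
  refine Finset.measurable_sum _ fun i _ => Measurable.ite ?_ measurable_const measurable_const
  exact (measurableSet_lt measurable_const measurable_coe_real_ereal).inter
    (measurableSet_le measurable_coe_real_ereal measurable_const)

omit he [IsOrderedAddMonoid E] [IsOrderedModule ℝ E] in
theorem HasMonotoneIntegral.measurable (h : HasMonotoneIntegral e x f y) : Measurable f := by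
  induction h with
  | step f y h => exact h.measurable
  | up u y f a _ _ hl _ ih => exact Measurable.isLUB ih hl
  | down u y f a _ _ hl _ ih => exact Measurable.isGLB ih hl

/-- The integral is composition with `f` at generic points, because suprema and infima of sequences
in `E` are evaluated pointwise. -/
theorem HasMonotoneIntegral.eventually_value_eq (h : HasMonotoneIntegral e x f y) :
    ∀ᶠ I in generic E, value e I y = f (value e I x) := by
  induction h with
  | step f y h => exact h.eventually_value_eq he
  | up u y f a _ _ hl ha ih =>
    filter_upwards [eventually_isLUB_value he ha, eventually_countable_forall.2 ih] with I h1 h2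
    simp only [h2] at h1
    exact h1.unique (hl _)
  | down u y f a _ _ hl ha ih =>
    filter_upwards [eventually_isGLB_value he ha, eventually_countable_forall.2 ih] with I h1 h2
    simp only [h2] at h1
    exact h1.unique (hl _)

omit he [IsOrderedAddMonoid E] [IsOrderedModule ℝ E] in
theorem HasMonotoneIntegral.zero (e x : E) : HasMonotoneIntegral e x (fun _ => 0) 0 :=
  .step _ _ ⟨0, Fin.elim0, Fin.elim0, Fin.elim0, fun i => i.elim0, by simp, by simp⟩

omit he [IsOrderedModule ℝ E] in
theorem HasMonotoneIntegral.add {a b : E} (hf : HasMonotoneIntegral e x f a)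
    (hg : HasMonotoneIntegral e x g b) : HasMonotoneIntegral e x (fun t => f t + g t) (a + b) := by
  simpa using hf.sub ((HasMonotoneIntegral.zero e x).sub hg)

omit he [IsOrderedModule ℝ E] in
theorem HasMonotoneIntegral.sum {ι : Type*} (s : Finset ι) {f : ι → ℝ → ℝ} {a : ι → E}
    (hf : ∀ i, HasMonotoneIntegral e x (f i) (a i)) :
    HasMonotoneIntegral e x (fun t => ∑ i ∈ s, f i t) (∑ i ∈ s, a i) := by
  classical
  induction s using Finset.induction_on with
  | empty => simpa using HasMonotoneIntegral.zero e x
  | insert i s hi ih => simpa only [Finset.sum_insert hi] using (hf i).add ih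

omit he [IsOrderedAddMonoid E] [IsOrderedModule ℝ E] in
theorem exists_hasMonotoneIntegral_const (c : ℝ) :
    ∃ y, HasMonotoneIntegral e x (fun _ => c) y :=
  ⟨_, .step _ _ ⟨1, fun _ => c, fun _ => ⊥, fun _ => ⊤, by simp, by simp, rfl⟩⟩

/-- A π-λ argument starting from the half-lines. The sign of `c` makes the partial disjoint unions
increase. -/
theorem exists_hasMonotoneIntegral_indicator_of_nonneg {c : ℝ} (hc : 0 ≤ c) {B : Set ℝ}
    (hB : MeasurableSet B) : ∃ y, HasMonotoneIntegral e x (B.indicator fun _ => c) y := by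
  induction B, hB using MeasurableSpace.induction_on_inter
    (BorelSpace.measurable_eq.trans (borel_eq_generateFrom_Iic ℝ)) isPiSystem_Iic with
  | empty =>
    refine ⟨0, ?_⟩
    rw [indicator_empty]
    exact HasMonotoneIntegral.zero e x
  | basic B hB =>
    obtain ⟨t, rfl⟩ := hB
    exact ⟨_, .step _ _ ⟨1, fun _ => c, fun _ => ⊥, fun _ => t, by simp,
      by simp [indicator_apply], rfl⟩⟩
  | compl B _ ih =>
    obtain ⟨y, hy⟩ := ih
    obtain ⟨z, hz⟩ := exists_hasMonotoneIntegral_const (e := e) (x := x) c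
    refine ⟨_, (show (Bᶜ.indicator fun _ => c) = fun t => c - B.indicator (fun _ => c) t from
      funext fun t => ?_) ▸ hz.sub hy⟩
    by_cases ht : t ∈ B <;> simp [ht]
  | iUnion B hd _ ih =>
    choose y hy using ih
    set u : ℕ → ℝ → ℝ := fun n => (⋃ i < n, B i).indicator fun _ => c with hu
    have hM : ∀ n, HasMonotoneIntegral e x (u n) (∑ i ∈ Finset.range n, y i) := by
      intro n
      induction n with
      | zero => simpa [hu] using HasMonotoneIntegral.zero e x
      | succ n ih =>
        rw [Finset.sum_range_succ]
        convert ih.add (hy n) using 1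
        simp only [hu]
        rw [biUnion_lt_succ, indicator_union_of_disjoint]
        rw [disjoint_iUnion₂_left]
        exact fun i hi => hd hi.ne
    have hm : Monotone u := fun m n hmn =>
      indicator_le_indicator_of_subset (biUnion_subset_biUnion_left fun i hi => lt_of_lt_of_le hi hmn)
        fun _ => hc
    -- This bound, read off from values, provides the supremum in `E` required by the `up`
    -- constructor.
    have hub : ∀ n, ∑ i ∈ Finset.range n, y i ≤ c • e := fun n => by
      rw [le_iff_eventually_value_le he]
      filter_upwards [(hM n).eventually_value_eq he, value_smul he c e] with I h1 h2
      rw [h1, h2, value_unit he, mul_one]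
      exact indicator_le_self' (fun _ _ => hc) _
    refine ⟨_, .up u _ _ _ hM hm (fun t => ?_)
      (isLUB_csSup (range_nonempty _) ⟨c • e, by rintro _ ⟨n, rfl⟩; exact hub n⟩)⟩
    constructor
    · rintro _ ⟨n, rfl⟩
      exact indicator_le_indicator_of_subset
        (iUnion₂_subset fun i _ => subset_iUnion B i) (fun _ => hc) t
    · intro b hb
      by_cases ht : t ∈ ⋃ i, B i
      · obtain ⟨i, hi⟩ := mem_iUnion.1 ht
        have h1 := hb ⟨i + 1, rfl⟩
        have h2 : t ∈ ⋃ j < i + 1, B j := mem_iUnion₂.2 ⟨i, i.lt_succ_self, hi⟩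
        simpa only [hu, indicator_of_mem ht, indicator_of_mem h2] using h1
      · have h1 := hb ⟨0, rfl⟩
        rw [indicator_of_notMem ht]
        simpa [hu] using h1

theorem exists_hasMonotoneIntegral_indicator (c : ℝ) {B : Set ℝ} (hB : MeasurableSet B) :
    ∃ y, HasMonotoneIntegral e x (B.indicator fun _ => c) y := by
  rcases le_total 0 c with hc | hc
  · exact exists_hasMonotoneIntegral_indicator_of_nonneg he hc hB
  · obtain ⟨y, hy⟩ := exists_hasMonotoneIntegral_indicator_of_nonneg he (x := x)
      (neg_nonneg.2 hc) hB
    refine ⟨_, (show (B.indicator fun _ => c) = fun t => 0 - B.indicator (fun _ => -c) t from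
      funext fun t => ?_) ▸ (HasMonotoneIntegral.zero e x).sub hy⟩
    by_cases ht : t ∈ B <;> simp [ht]

/-- Monotone limits pass through composition with `g`, so only step functions `f` matter. Then `f ∘
g` is a combination of indicators of Borel sets, and its integral is identified by values. -/
theorem HasMonotoneIntegral.comp {b : E} (hf : HasMonotoneIntegral e y f b)
    (hg : HasMonotoneIntegral e x g y) : HasMonotoneIntegral e x (fun t => f (g t)) b := by
  induction hf with
  | step f b h =>
    obtain ⟨n, α, l, r, hlr, hf, hb⟩ := id h
    have hB : ∀ i, ∃ z, HasMonotoneIntegral e x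
        (({t | l i < (g t : EReal) ∧ (g t : EReal) ≤ r i} : Set ℝ).indicator fun _ => α i) z :=
      fun i => exists_hasMonotoneIntegral_indicator he (α i)
        ((measurableSet_lt measurable_const hg.measurable.coe_real_ereal).inter
          (measurableSet_le hg.measurable.coe_real_ereal measurable_const))
    choose z hz using hB
    have h1 : HasMonotoneIntegral e x (fun t => f (g t)) (∑ i, z i) := by
      convert HasMonotoneIntegral.sum Finset.univ hz using 2 with t
      rw [hf]
      simp only [indicator_apply, mem_ofPred_eq]
    convert h1 using 1
    refine eq_of_eventually_value_eq he ?_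
    filter_upwards [h.eventually_value_eq he, h1.eventually_value_eq he,
      hg.eventually_value_eq he] with I h2 h3 h4
    rw [h2, h3, h4]
  | up u y f a _ hm hl ha ih =>
    exact .up _ y _ a ih (fun i j hij t => hm hij (g t)) (fun t => hl (g t)) ha
  | down u y f a _ hm hl ha ih =>
    exact .down _ y _ a ih (fun i j hij t => hm hij (g t)) (fun t => hl (g t)) ha

theorem HasExtIntegral.comp {f : ℝ → EReal} {a : SupCompletion E} (hf : HasExtIntegral e y f a)
    (hg : HasMonotoneIntegral e x g y) : HasExtIntegral e x (fun t => f (g t)) a := by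
  obtain ⟨u, z, hu, hm, hl, rfl⟩ := hf
  exact ⟨_, z, fun n => (hu n).comp he hg, fun i j hij t => hm hij (g t), fun t => hl (g t), rfl⟩

theorem exists_hasMonotoneIntegral_simpleFunc (s : MeasureTheory.SimpleFunc ℝ ℝ) :
    ∃ y, HasMonotoneIntegral e x s y := by
  induction s using MeasureTheory.SimpleFunc.induction with
  | @const c s hs =>
    obtain ⟨y, hy⟩ := exists_hasMonotoneIntegral_indicator he (x := x) c hs
    refine ⟨y, ?_⟩
    convert hy using 1
    ext t
    by_cases ht : t ∈ s <;> simp [ht]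
  | add _ ih₁ ih₂ =>
    obtain ⟨y, hy⟩ := ih₁
    obtain ⟨z, hz⟩ := ih₂
    exact ⟨y + z, hy.add hz⟩

-- The increasing approximation uses simple functions with finite values, as the monotone closure
-- contains only real-valued functions.
open scoped ENNReal in
theorem exists_hasExtIntegral {f : ℝ → EReal} (hf : Measurable f) (h0 : ∀ t, 0 ≤ f t) :
    ∃ a, HasExtIntegral e x f a := by
  have hf' : Measurable fun t => (f t).toENNReal := measurable_ereal_toENNReal.comp hf
  set s : ℕ → MeasureTheory.SimpleFunc ℝ ℝ≥0∞ :=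
    MeasureTheory.SimpleFunc.eapprox fun t => (f t).toENNReal
  have hs : ∀ n t, s n t ≠ ∞ := fun n t => (MeasureTheory.SimpleFunc.eapprox_lt_top _ n t).ne
  choose y hy using fun n =>
    exists_hasMonotoneIntegral_simpleFunc he (x := x) ((s n).map ENNReal.toReal)
  have hcoe : ∀ n t, (((s n).map ENNReal.toReal t : ℝ) : EReal) = (s n t : EReal) := fun n t => by
    rw [MeasureTheory.SimpleFunc.map_apply]
    exact EReal.coe_ennreal_toReal (hs n t)
  have hsup : ∀ t, ⨆ n, s n t = (f t).toENNReal :=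
    MeasureTheory.SimpleFunc.iSup_eapprox_apply hf'
  refine ⟨_, fun n => (s n).map ENNReal.toReal, y, hy, fun m n hmn t => ?_, fun t => ?_, rfl⟩
  · exact ENNReal.toReal_mono (hs n t) (MeasureTheory.SimpleFunc.monotone_eapprox _ hmn t)
  · simp only [hcoe]
    rw [← EReal.coe_toENNReal (h0 t), ← hsup]
    constructor
    · rintro _ ⟨n, rfl⟩
      exact EReal.coe_ennreal_le_coe_ennreal_iff.2 (le_iSup (fun n => s n t) n)
    · intro b hb
      have hb0 : 0 ≤ b := (EReal.coe_ennreal_nonneg _).trans (hb ⟨0, rfl⟩)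
      rw [← EReal.coe_toENNReal hb0]
      refine EReal.coe_ennreal_le_coe_ennreal_iff.2 (iSup_le fun n => ?_)
      rw [← EReal.coe_ennreal_le_coe_ennreal_iff, EReal.coe_toENNReal hb0]
      exact hb ⟨n, rfl⟩

end Integral

/-! ### The sup-completion described by values, and the product. -/

section Ext

open PosFilter

variable {E : Type*} [AddCommGroup E] [ConditionallyCompleteLattice E] [IsOrderedAddMonoid E]

/-- The right-hand condition defines an order closed lower set containing every `w n`. Conversely it
says that `z` is the supremum of the elements `z ⊓ w n`, which lie in every such set. -/
theorem SupCompletion.mem_sup_range_iff {w : ℕ → E} {z : E} :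
    z ∈ (SupCompletion.sup (range w) (range_nonempty w)).carrier ↔
      ∀ b, (∀ n, z ⊓ w n ≤ b) → z ≤ b := by
  constructor
  · intro hz
    refine hz {z | ∀ b, (∀ n, z ⊓ w n ≤ b) → z ≤ b} ⟨?_, ?_⟩ ?_
    · intro z z' hle hz b hb
      have h1 : z ≤ b + (z - z') := hz _ fun n => by
        have h2 : z ⊓ w n - (z - z') ≤ z' ⊓ w n := by
          refine le_inf ?_ ?_
          · rw [sub_le_iff_le_add, add_sub_cancel]
            exact inf_le_left
          · exact (sub_le_self _ (sub_nonneg.2 hle)).trans inf_le_right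
        exact sub_le_iff_le_add.1 (h2.trans (hb n))
      rw [← sub_le_iff_le_add, sub_sub_cancel] at h1
      exact h1
    · intro B hB _ b hb d hd
      exact hb.2 fun z hz => hB hz d fun n => (inf_le_inf_right _ (hb.1 hz)).trans (hd n)
    · rintro _ ⟨n, rfl⟩ b hb
      simpa using hb n
  · intro h A hA hw
    refine hA.2 (range fun n => z ⊓ w n) ?_ (range_nonempty _) z ⟨?_, ?_⟩
    · rintro _ ⟨n, rfl⟩
      exact hA.1 inf_le_right (hw ⟨n, rfl⟩)
    · rintro _ ⟨n, rfl⟩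
      exact inf_le_left
    · exact fun b hb => h b fun n => hb ⟨n, rfl⟩

theorem SupCompletion.mem_sup_range_iff_isLUB {w : ℕ → E} {z : E} :
    z ∈ (SupCompletion.sup (range w) (range_nonempty w)).carrier ↔
      IsLUB (range fun n => z ⊓ w n) z := by
  rw [SupCompletion.mem_sup_range_iff]
  refine ⟨fun h => ⟨?_, fun b hb => h b fun n => hb ⟨n, rfl⟩⟩, fun h b hb => h.2 ?_⟩
  · rintro _ ⟨n, rfl⟩
    exact inf_le_left
  · rintro _ ⟨n, rfl⟩
    exact hb n

theorem isLUB_range_min_iff {ι : Type*} {u : ι → ℝ} {z : ℝ} {s : EReal} [Nonempty ι]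
    (hs : IsLUB (range fun i => (u i : EReal)) s) :
    IsLUB (range fun i => min z (u i)) z ↔ (z : EReal) ≤ s := by
  constructor
  · intro h
    by_contra! hlt
    obtain ⟨c, hsc, hcz⟩ := EReal.lt_iff_exists_real_btwn.1 hlt
    refine (EReal.coe_lt_coe_iff.1 hcz).not_ge (h.2 ?_)
    rintro _ ⟨i, rfl⟩
    exact (min_le_right _ _).trans (EReal.coe_le_coe_iff.1 ((hs.1 ⟨i, rfl⟩).trans hsc.le))
  · intro h
    refine ⟨by rintro _ ⟨i, rfl⟩; exact min_le_left _ _, fun b hb => ?_⟩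
    by_contra! hlt
    obtain ⟨_, ⟨i, rfl⟩, hi, -⟩ := hs.exists_between ((EReal.coe_lt_coe_iff.2 hlt).trans_le h)
    exact (lt_min hlt (EReal.coe_lt_coe_iff.1 hi)).not_ge (hb ⟨i, rfl⟩)

variable [Module ℝ E] [IsOrderedModule ℝ E] {e : E} {x y : E} {f g : ℝ → EReal}
  {a b c : SupCompletion E}

omit [IsOrderedAddMonoid E] [IsOrderedModule ℝ E] in
theorem HasExtIntegral.measurable (hf : HasExtIntegral e x f a) : Measurable f := by
  obtain ⟨u, z, hu, hm, hl, rfl⟩ := hf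
  exact Measurable.isLUB (fun n => (hu n).measurable.coe_real_ereal) hl

variable (he : IsWeakOrderUnit e)
include he

/-- Membership means that `z` is the supremum of the `z ⊓ w n`, a countable supremum in `E`, which
can be tested on values. -/
theorem HasExtIntegral.mem_carrier_iff (hf : HasExtIntegral e x f a) {z : E} :
    z ∈ a.carrier ↔ ∀ᶠ I in generic E, (value e I z : EReal) ≤ f (value e I x) := by
  obtain ⟨u, w, hu, hm, hl, rfl⟩ := hf
  have h1 : ∀ᶠ I in generic E, ∀ n,
      value e I (z ⊓ w n) = min (value e I z) (u n (value e I x)) := by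
    filter_upwards [eventually_countable_forall.2 fun n => value_inf he z (w n),
      eventually_countable_forall.2 fun n => (hu n).eventually_value_eq he] with I h1 h2 n
    rw [h1, h2]
  rw [SupCompletion.mem_sup_range_iff_isLUB]
  constructor
  · intro h
    filter_upwards [h1, eventually_isLUB_value he h] with I h1 h2
    simp only [h1] at h2
    exact (isLUB_range_min_iff (hl _)).1 h2
  · intro h
    refine isLUB_of_eventually he ?_
    filter_upwards [h1, h] with I h1 h2
    simp only [h1]
    exact (isLUB_range_min_iff (hl _)).2 h2

theorem HasExtIntegral.unique (h : HasExtIntegral e x f a) (h' : HasExtIntegral e x f b) :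
    a = b := by
  ext z
  rw [h.mem_carrier_iff he, h'.mem_carrier_iff he]

theorem value_eq_zero_or_one_of_component {p : E} (hp : p ⊓ (e - p) = 0) :
    ∀ᶠ I in generic E, value e I p = 0 ∨ value e I p = 1 := by
  filter_upwards [value_inf he p (e - p), value_sub he e p] with I h1 h2
  rw [hp, value_zero he, h2, value_unit he] at h1
  rcases min_choice (value e I p) (1 - value e I p) with h | h <;> rw [h] at h1
  · exact .inl h1.symm
  · exact .inr (by linarith)

open Classical in
theorem exists_component_of_measurableSet (x : E) {B : Set ℝ} (hB : MeasurableSet B) :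
    ∃ p, p ⊓ (e - p) = 0 ∧
      ∀ᶠ I in generic E, value e I p = if value e I x ∈ B then 1 else 0 := by
  obtain ⟨p, hp⟩ := exists_hasMonotoneIntegral_indicator he (x := x) 1 hB
  have h := hp.eventually_value_eq he
  simp only [indicator_apply] at h
  refine ⟨p, eq_of_eventually_value_eq he ?_, h⟩
  filter_upwards [h, value_inf he p (e - p), value_sub he e p] with I h1 h2 h3
  rw [h2, h3, value_unit he, value_zero he, h1]
  split_ifs <;> simp

/-- Components of `e` have values 0 or 1, so each product in the definition of `mul` lies below `c`.
Conversely the level sets `{f ≥ q}` and `{g ≥ s}`, with rational `q, s ≥ 0`, give countably many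
such products whose pointwise supremum is `f g`. -/
theorem HasExtIntegral.mul (hf : HasExtIntegral e x f a) (hg : HasExtIntegral e x g b)
    (hf0 : ∀ t, 0 ≤ f t) (hg0 : ∀ t, 0 ≤ g t) (hc : HasExtIntegral e x (fun t => f t * g t) c) :
    c = a.mul e b := by
  classical
  ext z
  rw [hc.mem_carrier_iff he]
  constructor
  · intro hz A hA hS
    -- `max q 0` lets all rationals serve as indices while the coefficients stay nonnegative.
    choose p hp hpv using fun q : ℚ => exists_component_of_measurableSet he x
      (measurableSet_le measurable_const hf.measurable :
        MeasurableSet {t | (((max q 0 : ℚ) : ℝ) : EReal) ≤ f t})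
    choose r hr hrv using fun q : ℚ => exists_component_of_measurableSet he x
      (measurableSet_le measurable_const hg.measurable :
        MeasurableSet {t | (((max q 0 : ℚ) : ℝ) : EReal) ≤ g t})
    replace hpv : ∀ q : ℚ, ∀ᶠ I in generic E, value e I (p q) =
        if (((max q 0 : ℚ) : ℝ) : EReal) ≤ f (value e I x) then 1 else 0 := fun q =>
      (hpv q).mono fun I h => by rw [h]; congr
    replace hrv : ∀ q : ℚ, ∀ᶠ I in generic E, value e I (r q) =
        if (((max q 0 : ℚ) : ℝ) : EReal) ≤ g (value e I x) then 1 else 0 := fun q =>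
      (hrv q).mono fun I h => by rw [h]; congr
    have hnn : ∀ q : ℚ, 0 ≤ ((max q 0 : ℚ) : ℝ) := fun q => by exact_mod_cast le_max_right q 0
    have hmem : ∀ {h : ℝ → EReal} {d : SupCompletion E} {q : ℚ} {s : E}, HasExtIntegral e x h d →
        (∀ t, 0 ≤ h t) → (∀ᶠ I in generic E, value e I s =
          if (((max q 0 : ℚ) : ℝ) : EReal) ≤ h (value e I x) then 1 else 0) →
        ((max q 0 : ℚ) : ℝ) • s ∈ d.carrier := by
      intro h d q s hd h0 hs
      rw [hd.mem_carrier_iff he]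
      filter_upwards [hs, value_smul he ((max q 0 : ℚ) : ℝ) s] with I h1 h2
      rw [h2, h1]
      split_ifs with hle
      · simpa only [mul_one] using hle
      · simpa using h0 _
    set w : ℚ × ℚ → E := fun i => (((max i.1 0 : ℚ) : ℝ) * ((max i.2 0 : ℚ) : ℝ)) • (p i.1 ⊓ r i.2)
      with hw
    have hwA : ∀ i, w i ∈ A := fun i => hS (.inr ⟨_, _, p i.1, r i.2, hnn _, hnn _, hp _, hr _,
      hmem hf hf0 (hpv _), hmem hg hg0 (hrv _), rfl⟩)
    refine hA.2 (range fun i => z ⊓ w i) ?_ (range_nonempty _) z (isLUB_of_eventually he ?_)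
    · rintro _ ⟨i, rfl⟩
      exact hA.1 inf_le_right (hwA i)
    filter_upwards [hz, eventually_countable_forall.2 fun i => value_inf he z (w i),
      eventually_countable_forall.2 fun i : ℚ × ℚ => value_smul he
        (((max i.1 0 : ℚ) : ℝ) * ((max i.2 0 : ℚ) : ℝ)) (p i.1 ⊓ r i.2),
      eventually_countable_forall.2 fun i : ℚ × ℚ => value_inf he (p i.1) (r i.2),
      eventually_countable_forall.2 hpv, eventually_countable_forall.2 hrv]
      with I h1 h2 h3 h4 h5 h6
    have hv : ∀ i, value e I (z ⊓ w i) = min (value e I z)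
        (((max i.1 0 : ℚ) : ℝ) * ((max i.2 0 : ℚ) : ℝ) *
          min (if (((max i.1 0 : ℚ) : ℝ) : EReal) ≤ f (value e I x) then 1 else 0)
            (if (((max i.2 0 : ℚ) : ℝ) : EReal) ≤ g (value e I x) then 1 else 0)) := fun i => by
      rw [h2, hw, h3, h4, h5, h6]
    refine ⟨by rintro _ ⟨i, rfl⟩; simp only [hv]; exact min_le_left _ _, fun d hd => ?_⟩
    by_contra! hlt
    have hd' : ∀ i : ℚ × ℚ, (((max i.1 0 : ℚ) : ℝ) : EReal) ≤ f (value e I x) →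
        (((max i.2 0 : ℚ) : ℝ) : EReal) ≤ g (value e I x) →
        ((max i.1 0 : ℚ) : ℝ) * ((max i.2 0 : ℚ) : ℝ) ≤ d := by
      intro i hi hi'
      have := hd ⟨i, rfl⟩
      simp only [hv, if_pos hi, if_pos hi', min_self, mul_one, min_le_iff] at this
      exact this.resolve_left hlt.not_ge
    have hd0 : 0 ≤ d := by simpa using hd' (0, 0) (by simpa using hf0 _) (by simpa using hg0 _)
    refine (EReal.coe_lt_coe_iff.2 hlt).not_ge (h1.trans ?_)
    -- The product is approached from below by products of smaller factors, between which and `f`,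
    -- `g` rationals can be inserted; this also covers `0 · ∞`.
    refine EReal.mul_le_of_forall_lt_of_nonneg (hf0 _) (by exact_mod_cast hd0) ?_
    intro α hα β hβ
    obtain ⟨q, hq1, hq2⟩ := EReal.lt_iff_exists_rat_btwn.1 hα.2
    obtain ⟨s, hs1, hs2⟩ := EReal.lt_iff_exists_rat_btwn.1 hβ.2
    have hq0 : 0 ≤ q := by exact_mod_cast (hα.1.trans hq1).le
    have hs0 : 0 ≤ s := by exact_mod_cast (hβ.1.trans hs1).le
    have h7 := hd' (q, s) (by rw [max_eq_left hq0]; exact hq2.le)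
      (by rw [max_eq_left hs0]; exact hs2.le)
    simp only [max_eq_left hq0, max_eq_left hs0] at h7
    calc α * β ≤ (((q : ℝ) : EReal)) * ((s : ℝ) : EReal) :=
          mul_le_mul hq1.le hs1.le hβ.1.le (by exact_mod_cast hq0)
      _ ≤ d := by exact_mod_cast h7
  · intro hz
    rw [← hc.mem_carrier_iff he]
    refine hz c.carrier c.closed' (insert_subset ?_ ?_)
    · rw [hc.mem_carrier_iff he]
      refine Eventually.of_forall fun I => ?_
      rw [value_zero he]
      exact mul_nonneg (hf0 _) (hg0 _)
    · rintro _ ⟨α, β, p, q, hα, hβ, hp, hq, hpa, hqb, rfl⟩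
      rw [hf.mem_carrier_iff he] at hpa
      rw [hg.mem_carrier_iff he] at hqb
      rw [hc.mem_carrier_iff he]
      filter_upwards [hpa, hqb, value_eq_zero_or_one_of_component he hp,
        value_eq_zero_or_one_of_component he hq, value_smul he α p, value_smul he β q,
        value_smul he (α * β) (p ⊓ q), value_inf he p q] with I h1 h2 h3 h4 h5 h6 h7 h8
      rw [h7, h8]
      rw [h5] at h1
      rw [h6] at h2
      have h0 : (0 : EReal) ≤ f (value e I x) * g (value e I x) := mul_nonneg (hf0 _) (hg0 _)
      -- If either component has value 0 the claim is `0 ≤ f g`; only the case where both are 1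
      -- remains afterwards.
      rcases h3 with h3 | h3 <;> rcases h4 with h4 | h4 <;> rw [h3] at h1 ⊢ <;> rw [h4] at h2 ⊢ <;>
        simp only [min_self, mul_zero, mul_one, EReal.coe_zero, h0, zero_le_one, min_eq_left,
          min_eq_right] at h1 h2 ⊢
      rw [EReal.coe_mul]
      exact mul_le_mul h1 h2 (by exact_mod_cast hβ) (hf0 _)

end Ext

/-! ### The theorem. -/

theorem mainTheorem11 {E : Type*} [AddCommGroup E] [ConditionallyCompleteLattice E]
    [IsOrderedAddMonoid E] [Module ℝ E] [IsOrderedModule ℝ E]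
    (e : E) (he : IsWeakOrderUnit e) (x : E) :
    (∀ (f g : ℝ → EReal) (a b : SupCompletion E),
      HasL2Integral e x f a → HasL2Integral e x g b → (∀ t, 0 ≤ f t) → (∀ t, 0 ≤ g t) →
        ∀ c : SupCompletion E, HasExtIntegral e x (fun t => f t * g t) c ↔ c = a.mul e b) ∧
    (∀ (g : ℝ → ℝ) (y : E), HasL1Integral e x g y →
      ∀ (f : ℝ → EReal) (a : SupCompletion E), HasL2Integral e y f a →
        ∀ c : SupCompletion E, HasExtIntegral e x (fun t => f (g t)) c ↔ c = a) := by
  refine ⟨fun f g a b hf hg hf0 hg0 c => ?_, fun g y hg f a hf c => ?_⟩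
  · have hf' := hf.hasExtIntegral
    have hg' := hg.hasExtIntegral
    refine ⟨fun hc => hf'.mul he hg' hf0 hg0 hc, ?_⟩
    rintro rfl
    -- Some value of `f g` exists because the product is a nonnegative Borel function; the product
    -- formula then identifies it.
    have hmeas : Measurable fun t => f t * g t := by
      have h1 : (fun t => f t * g t) =
          fun t => (((f t).toENNReal * (g t).toENNReal : ENNReal) : EReal) := by
        funext t
        rw [EReal.coe_ennreal_mul, EReal.coe_toENNReal (hf0 t), EReal.coe_toENNReal (hg0 t)]
      rw [h1]
      exact ((measurable_ereal_toENNReal.comp hf'.measurable).mul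
        (measurable_ereal_toENNReal.comp hg'.measurable)).coe_ereal_ennreal
    obtain ⟨c, hc⟩ := exists_hasExtIntegral he (x := x) hmeas
      fun t => mul_nonneg (hf0 t) (hg0 t)
    exact hf'.mul he hg' hf0 hg0 hc ▸ hc
  · obtain ⟨u, v, p, q, hu, hv, huv, rfl⟩ := hg
    have hg' : HasMonotoneIntegral e x g (p - q) := by
      rw [show g = fun t => u t - v t from funext huv]
      exact hu.hasMonotoneIntegral.sub hv.hasMonotoneIntegral
    have h := hf.hasExtIntegral.comp he hg'
    exact ⟨fun hc => hc.unique he h, fun hc => hc ▸ h⟩
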